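/- **Conventions.** Locales are identified with frames; a map of locales $f:X\to Y$ is a frame homomorphism $f^*:Y\to X$ (its inverse image). $f$ is a *surjection* if $f^*$ is injective, and *open* if $f^*$ has a left adjoint $f_!$ (the direct image) with $f_!(x\wedge f^*(y))=f_!(x)\wedge y$. For a locale $A$, an $A$-action on a sup-lattice preserves joins in each variable and satisfies $1_A m=m$, $(a\wedge b)m=a(bm)$ (similarly on the right); left and right actions are written ${}_{a|}m$ and $m_{|a}$. A *groupoid quantale* $Q$ over a locale $A$ is a frame $Q$ with an associative multiplication preserving joins in each variable, a join-preserving involution $*$ with $(xy)^*=y^*x^*$, and left and right $A$-actions such that $({}_{a|}x)_{|b}={}_{a|}(x_{|b})$, $({}_{a|}x)y={}_{a|}(xy)$, $(x_{|a})y=x({}_{a|}y)$, $(xy)_{|a}=x(y_{|a})$, $({}_{a|}x_{|b})^*={}_{b|}x^*{}_{|a}$, $({}_{a|}x)\wedge y={}_{a|}(x\wedge y)$, $y\wedge(x_{|a})=(y\wedge x)_{|a}$; together with a join-preserving support $\varsigma_Q:Q\to A$ with $\varsigma_Q(1_Q)=1_A$, ${}_{\varsigma_Q(x)|}y\le xx^*y$,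 ${}_{\varsigma_Q(x)|}x=x$, $\varsigma_Q({}_{a|}x)=a\wedge\varsigma_Q(x)$, and a frame homomorphism $\upsilon:Q\to A$ with $\upsilon({}_{a|}1_Q)=a=\upsilon(1_{Q|a})$; such that the right adjoint $\mu_*$ of the multiplication $\mu:Q\otimes_AQ\to Q$ preserves joins, $\bigvee_{xy\le a}{}_{\upsilon(x)|}y=a$ and ${}_{\upsilon(a)|}1_Q=\bigvee_{xx^*\le a}x$ for all $a\in Q$. Here $\otimes_A$ is the tensor product of sup-lattices over $A$. Its *groupoid* $\mathcal G(Q)$ is the open localic groupoid with locale of objects $A$, locale of arrows $Q$, and structure maps given by $d^*(a)={}_{a|}1_Q$, $r^*(a)=1_{Q|a}$, $u^*=\upsilon$, $i^*(q)=q^*$, and $m^*=\mu_*$, where $G_2=Q\otimes_AQ$ is the pullback of $r$ and $d$. A *$Q$-locale* is a locale $X$ with an associative action $(q,x)\mapsto q\cdot x$ of $Q$ preserving joins in each variable, a left $A$-action with $({}_{a|}q)\cdot x={}_{a|}(q\cdot x)$, $(q_{|a})\cdot x=q\cdot({}_{a|}x)$, ${}_{a|}(x\wedge y)=({}_{a|}x)\wedge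 y$; a map $\langle-,-\rangle:X\times X\to Q$ preserving joins in the first variable with $\langle q\cdot x,y\rangle=q\langle x,y\rangle$, ${}_{a|}\langle x,1_X\rangle=\langle{}_{a|}x,1_X\rangle$, $\langle x,y\rangle=\langle y,x\rangle^*$; and a monotone $\varsigma_X:X\to A$ with $\varsigma_X(1_X)=1_A$, ${}_{\varsigma_X(x)|}1_X\le\langle x,x\rangle\cdot1_X$, ${}_{\varsigma_X(x)|}x=x$, $\varsigma_X(q\cdot x)\le\varsigma_Q(q)$; such that, for the module action $\alpha:Q\otimes_AX\to X$, $q\otimes x\mapsto q\cdot x$, the right adjoint $\alpha_*(x)=\bigvee_{q\cdot y\le x}q\otimes y$ preserves joins, and $\bigvee_{q\cdot y\le x}{}_{\upsilon(q)|}y=x$ for all $x\in X$. For an open localic groupoid $G$ with multiplication $m:G_2=G_1\times_{G_0}G_1\to G_1$ (pullback of $r$ and $d$), a *$G$-locale* is a triple $(X,\mathfrak a,p)$ with maps of locales $p:X\to G_0$ (the anchor map) and $\mathfrak a:G_1\times_{G_0}X\to X$ (the action; the pullback is that of $r$ and $p$) such that $p\circ\mathfrak a=d\circ\pi_1$, $\mathfrak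 a$ is associative with respect to $m$, and $\mathfrak a\circ\langle u\circ p,\mathrm{id}_X\rangle=\mathrm{id}_X$. It is *fully open* if $p$ is an open surjection. **Theorem.** Let $Q$ be a groupoid quantale over $A$ and let $X$ be a $Q$-locale. Then the locale $Q\otimes_AX$, with the projections $\pi_1^*(q)=q\otimes1_X$ and $\pi_2^*(x)=1_Q\otimes x$, is a pullback $G_1\times_{G_0}X$ for $G=\mathcal G(Q)$, and there are maps of locales $p:X\to A$ and $\mathfrak a:Q\otimes_AX\to X$ such that $(X,\mathfrak a,p)$ is a fully open $\mathcal G(Q)$-locale, the direct image of $p$ is $p_!=\varsigma_X$, and the inverse image of $\mathfrak a$ is $\mathfrak a^*=\alpha_*$, the right adjoint of the module action $\alpha$. -/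

import Mathlib

open CategoryTheory

universe u

namespace OpenGpd

/-! ## Locales and their maps

The category of locales is Mathlib's `Locale`, the opposite of the category of frames. -/

/-- The inverse image homomorphism `f^* : Y → X` of a map of locales `f : X ⟶ Y`. -/
def invImage {X Y : Locale.{u}} (f : X ⟶ Y) : FrameHom Y X :=
  Frm.Hom.hom (Quiver.Hom.unop f)

/-- The map of locales with a given inverse image homomorphism. -/
def mapOf {X Y : Type u} [Order.Frame X] [Order.Frame Y] (f : FrameHom Y X) :
    Locale.of X ⟶ Locale.of Y :=
  Quiver.Hom.op (Frm.ofHom f)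

/-- The inverse image homomorphism of a map into the locale of a frame `Y`. -/
def frameHom {X : Locale.{u}} {Y : Type u} [Order.Frame Y] (f : X ⟶ Locale.of Y) : FrameHom Y X :=
  invImage f

theorem invImage_mapOf {X Y : Type u} [Order.Frame X] [Order.Frame Y] (f : FrameHom Y X) :
    invImage (mapOf f) = f := rfl

theorem invImage_comp {X Y Z : Locale.{u}} (f : X ⟶ Y) (g : Y ⟶ Z) (z : Z) :
    invImage (f ≫ g) z = invImage f (invImage g z) := rfl

theorem invImage_id {X : Locale.{u}} (x : X) : invImage (𝟙 X) x = x := rfl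

theorem map_ext {X Y : Locale.{u}} {f g : X ⟶ Y} (h : ∀ y, invImage f y = invImage g y) : f = g := by
  apply Quiver.Hom.unop_inj
  exact Frm.ext h

theorem mapOf_ext {X : Locale.{u}} {Q : Type u} [Order.Frame Q] {f g : X ⟶ Locale.of Q}
    (h : ∀ q : Q, frameHom f q = frameHom g q) : f = g := map_ext h

/-- `IsDirectImage f s`: the function `s` is the direct image `f_!` of `f`, that is, the left
adjoint of the inverse image `f^*`. -/
def IsDirectImage {X Y : Locale.{u}} (f : X ⟶ Y) (s : X → Y) : Prop :=
  GaloisConnection s (invImage f)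

/-- A map of locales is open if its inverse image has a left adjoint `f_!` (the map is semiopen)
and the Frobenius condition holds. -/
def IsOpenLocaleMap {X Y : Locale.{u}} (f : X ⟶ Y) : Prop :=
  ∃ s : X → Y, IsDirectImage f s ∧ ∀ (a : X) (b : Y), s (a ⊓ invImage f b) = s a ⊓ b

/-- A map of locales is a surjection if its inverse image homomorphism is injective. -/
def IsLocaleSurjection {X Y : Locale.{u}} (f : X ⟶ Y) : Prop :=
  Function.Injective (invImage f)

/-! ## Localic groupoids and their actions -/

/-- An internal groupoid in the category of locales. Here `comp` is the locale `G₂` of composable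
pairs, the pullback of `r` and `d`; the product of `(g, h)` is defined when `r g = d h`.
The associativity law is stated for generalized elements `T ⟶ G₁`; taking for `T` the locale of
composable triples one obtains the usual commutative diagram, and conversely. -/
structure LocalicGroupoid where
  obj : Locale.{u}
  arr : Locale.{u}
  comp : Locale.{u}
  d : arr ⟶ obj
  r : arr ⟶ obj
  unit : obj ⟶ arr
  i : arr ⟶ arr
  π₁ : comp ⟶ arr
  π₂ : comp ⟶ arr
  m : comp ⟶ arr
  isPullback : IsPullback π₁ π₂ r d
  unit_d : unit ≫ d = 𝟙 obj
  unit_r : unit ≫ r = 𝟙 obj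
  m_d : m ≫ d = π₁ ≫ d
  m_r : m ≫ r = π₂ ≫ r
  assoc : ∀ (T : Locale.{u}) (g h k : T ⟶ arr) (gh : g ≫ r = h ≫ d) (hk : h ≫ r = k ≫ d),
    isPullback.lift (isPullback.lift g h gh ≫ m) k
        (by rw [Category.assoc, m_r, IsPullback.lift_snd_assoc, hk]) ≫ m =
      isPullback.lift g (isPullback.lift h k hk ≫ m)
        (by rw [Category.assoc, m_d, IsPullback.lift_fst_assoc, gh]) ≫ m
  unit_mul : isPullback.lift (d ≫ unit) (𝟙 arr)
      (by rw [Category.assoc, unit_r, Category.comp_id, Category.id_comp]) ≫ m = 𝟙 arr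
  mul_unit : isPullback.lift (𝟙 arr) (r ≫ unit)
      (by rw [Category.assoc, unit_d, Category.comp_id, Category.id_comp]) ≫ m = 𝟙 arr
  i_d : i ≫ d = r
  i_r : i ≫ r = d
  mul_inv : isPullback.lift (𝟙 arr) i (by rw [i_d, Category.id_comp]) ≫ m = d ≫ unit
  inv_mul : isPullback.lift i (𝟙 arr) (by rw [i_r, Category.id_comp]) ≫ m = r ≫ unit

/-- A localic groupoid is open if its domain map is open. -/
def LocalicGroupoid.IsOpen (G : LocalicGroupoid.{u}) : Prop :=
  IsOpenLocaleMap G.d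

/-- `IsGLocale G ρ₁ ρ₂ p act`: the locale `P`, with the projections `ρ₁` and `ρ₂`, is the pullback
`G₁ ×_{G₀} X` of `r` and `p`, and `(X, act, p)` is a left `G`-locale, with anchor map `p` and
action `act`. Associativity is again stated for generalized elements. -/
structure IsGLocale (G : LocalicGroupoid.{u}) {X P : Locale.{u}} (ρ₁ : P ⟶ G.arr) (ρ₂ : P ⟶ X)
    (p : X ⟶ G.obj) (act : P ⟶ X) : Prop where
  isPullback : IsPullback ρ₁ ρ₂ G.r p
  act_p : act ≫ p = ρ₁ ≫ G.d
  assoc : ∀ (T : Locale.{u}) (g h : T ⟶ G.arr) (x : T ⟶ X) (gh : g ≫ G.r = h ≫ G.d)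
      (hx : h ≫ G.r = x ≫ p),
    isPullback.lift g (isPullback.lift h x hx ≫ act)
        (by rw [Category.assoc, act_p, IsPullback.lift_fst_assoc, gh]) ≫ act =
      isPullback.lift (G.isPullback.lift g h gh ≫ G.m) x
        (by rw [Category.assoc, G.m_r, IsPullback.lift_snd_assoc, hx]) ≫ act
  unit_act : isPullback.lift (p ≫ G.unit) (𝟙 X)
      (by rw [Category.assoc, G.unit_r, Category.comp_id, Category.id_comp]) ≫ act = 𝟙 X

/-- A fully open `G`-locale: a `G`-locale whose anchor map is an open surjection. -/
structure IsFullyOpenGLocale (G : LocalicGroupoid.{u}) {X P : Locale.{u}} (ρ₁ : P ⟶ G.arr)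
    (ρ₂ : P ⟶ X) (p : X ⟶ G.obj) (act : P ⟶ X) : Prop
    extends IsGLocale G ρ₁ ρ₂ p act where
  isOpen : IsOpenLocaleMap p
  surjective : IsLocaleSurjection p

/-! ## Modules over a locale and their tensor products -/

/-- A unital left `A`-module structure on the sup-lattice `M`, for a locale `A`
(regarded as a quantale with multiplication `⊓` and unit `⊤`). -/
class LeftAModule (A M : Type u) [Order.Frame A] [CompleteLattice M] where
  lres : A → M → M
  top_lres : ∀ m, lres ⊤ m = m
  inf_lres : ∀ a b m, lres (a ⊓ b) m = lres a (lres b m)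
  sSup_lres : ∀ (S : Set A) m, lres (sSup S) m = ⨆ a ∈ S, lres a m
  lres_sSup : ∀ a (S : Set M), lres a (sSup S) = ⨆ m ∈ S, lres a m

/-- A unital right `A`-module structure on the sup-lattice `M`. -/
class RightAModule (A M : Type u) [Order.Frame A] [CompleteLattice M] where
  rres : M → A → M
  rres_top : ∀ m, rres m ⊤ = m
  rres_inf : ∀ m a b, rres m (a ⊓ b) = rres (rres m a) b
  rres_sSup : ∀ m (S : Set A), rres m (sSup S) = ⨆ a ∈ S, rres m a
  sSup_rres : ∀ (S : Set M) a, rres (sSup S) a = ⨆ m ∈ S, rres m a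

infixr:73 " ⇀ " => LeftAModule.lres
infixl:73 " ↼ " => RightAModule.rres

/-- The compatibility of a left `A`-action on a locale with binary meets. -/
class LeftLocalic (A M : Type u) [Order.Frame A] [Order.Frame M] [LeftAModule A M] : Prop where
  lres_inf : ∀ (a : A) (x y : M), (a ⇀ x) ⊓ y = a ⇀ (x ⊓ y)

/-- The compatibility of a right `A`-action on a locale with binary meets. -/
class RightLocalic (A M : Type u) [Order.Frame A] [Order.Frame M] [RightAModule A M] : Prop where
  inf_rres : ∀ (a : A) (x y : M), y ⊓ (x ↼ a) = (y ⊓ x) ↼ a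

/-- The tensor product `M ⊗_A N` of sup-lattices, concretely: its elements are the subsets of
`M × N` that are closed under joins in each variable and under the identification of
`(m ↼ a, n)` with `(m, a ⇀ n)`, ordered by inclusion. -/
@[ext]
structure Tensor (A M N : Type u) [Order.Frame A] [CompleteLattice M] [CompleteLattice N]
    [RightAModule A M] [LeftAModule A N] where
  carrier : Set (M × N)
  lower : ∀ {m m' n n'}, m' ≤ m → n' ≤ n → (m, n) ∈ carrier → (m', n') ∈ carrier
  sSup_left : ∀ (S : Set M) (n : N), (∀ m ∈ S, (m, n) ∈ carrier) → (sSup S, n) ∈ carrier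
  sSup_right : ∀ (m : M) (S : Set N), (∀ n ∈ S, (m, n) ∈ carrier) → (m, sSup S) ∈ carrier
  balanced : ∀ (m : M) (a : A) (n : N), (m ↼ a, n) ∈ carrier ↔ (m, a ⇀ n) ∈ carrier

namespace Tensor

section SupLattice

variable {A M N : Type u} [Order.Frame A] [CompleteLattice M] [CompleteLattice N]
  [RightAModule A M] [LeftAModule A N]

instance : SetLike (Tensor A M N) (M × N) where
  coe D := D.carrier
  coe_injective _ _ h := Tensor.ext h

instance : PartialOrder (Tensor A M N) := PartialOrder.ofSetLike _ _

instance : InfSet (Tensor A M N) where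
  sInf 𝒮 :=
    { carrier := {x | ∀ D ∈ 𝒮, x ∈ D}
      lower := fun h₁ h₂ h D hD => D.lower h₁ h₂ (h D hD)
      sSup_left := fun S n h D hD => D.sSup_left S n fun m hm => h m hm D hD
      sSup_right := fun m S h D hD => D.sSup_right m S fun n hn => h n hn D hD
      balanced := fun m a n => forall₂_congr fun D _ => D.balanced m a n }

instance : CompleteLattice (Tensor A M N) :=
  { completeLatticeOfInf (Tensor A M N) (fun _ =>
      ⟨fun _ hD _ hx => hx _ hD, fun _ hE _ hx _ hD => hE hD hx⟩) with
    inf := fun D E =>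
      { carrier := {x | x ∈ D ∧ x ∈ E}
        lower := fun h₁ h₂ h => ⟨D.lower h₁ h₂ h.1, E.lower h₁ h₂ h.2⟩
        sSup_left := fun S n h =>
          ⟨D.sSup_left S n fun m hm => (h m hm).1, E.sSup_left S n fun m hm => (h m hm).2⟩
        sSup_right := fun m S h =>
          ⟨D.sSup_right m S fun n hn => (h n hn).1, E.sSup_right m S fun n hn => (h n hn).2⟩
        balanced := fun m a n => and_congr (D.balanced m a n) (E.balanced m a n) }
    inf_le_left := fun _ _ _ h => h.1
    inf_le_right := fun _ _ _ h => h.2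
    le_inf := fun _ _ _ h₁ h₂ _ h => ⟨h₁ h, h₂ h⟩
    top := ⟨Set.univ, fun _ _ _ => trivial, fun _ _ _ => trivial, fun _ _ _ => trivial,
      fun _ _ _ => Iff.rfl⟩
    le_top := fun _ _ _ => trivial }

theorem mem_inf {D E : Tensor A M N} {x : M × N} : x ∈ D ⊓ E ↔ x ∈ D ∧ x ∈ E := Iff.rfl

theorem mem_top (x : M × N) : x ∈ (⊤ : Tensor A M N) := trivial

/-- The pure tensor `m ⊗ n`. -/
def tmul (A : Type u) {M N : Type u} [Order.Frame A] [CompleteLattice M] [CompleteLattice N]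
    [RightAModule A M] [LeftAModule A N] (m : M) (n : N) : Tensor A M N :=
  sInf {D | (m, n) ∈ D}

theorem tmul_le {m : M} {n : N} {D : Tensor A M N} : tmul A m n ≤ D ↔ (m, n) ∈ D :=
  ⟨fun h => h fun _ hE => hE, fun h => sInf_le h⟩

theorem mem_tmul (m : M) (n : N) : (m, n) ∈ tmul A m n := tmul_le.1 le_rfl

theorem eq_sSup_tmul (D : Tensor A M N) : D = ⨆ x ∈ D, tmul A x.1 x.2 :=
  le_antisymm
    (fun x hx => tmul_le.1 (le_iSup₂ (f := fun (x : M × N) (_ : x ∈ D) => tmul A x.1 x.2) x hx))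
    (iSup₂_le fun _ hx => tmul_le.2 hx)

/-- Balanced maps `M × N → L` that preserve joins in each variable. -/
structure IsBimorphism (A : Type u) {M N L : Type u} [Order.Frame A] [CompleteLattice M]
    [CompleteLattice N] [RightAModule A M] [LeftAModule A N] [CompleteLattice L]
    (f : M → N → L) : Prop where
  sSup_left : ∀ (S : Set M) n, f (sSup S) n = ⨆ m ∈ S, f m n
  sSup_right : ∀ m (S : Set N), f m (sSup S) = ⨆ n ∈ S, f m n
  balanced : ∀ m (a : A) n, f (m ↼ a) n = f m (a ⇀ n)

variable {L : Type u} [CompleteLattice L]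

/-- The map `M ⊗_A N → L` that a bimorphism `f` induces, `m ⊗ n ↦ f m n`. -/
def lift (f : M → N → L) (D : Tensor A M N) : L :=
  ⨆ x ∈ D, f x.1 x.2

/-- The map `L → M ⊗_A N`, `c ↦ ⋁ {m ⊗ n | f m n ≤ c}`. -/
def adj (A : Type u) {M N L : Type u} [Order.Frame A] [CompleteLattice M]
    [CompleteLattice N] [RightAModule A M] [LeftAModule A N] [CompleteLattice L]
    (f : M → N → L) (c : L) : Tensor A M N :=
  sSup {t | ∃ m n, f m n ≤ c ∧ t = tmul A m n}


namespace IsBimorphism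

variable {f : M → N → L}

theorem mono (hf : IsBimorphism A f) {m m' n n'} (h₁ : m' ≤ m) (h₂ : n' ≤ n) :
    f m' n' ≤ f m n := by
  have e1 : f m n' = ⨆ k ∈ ({m', m} : Set M), f k n' := by
    rw [← hf.sSup_left, sSup_pair, sup_eq_right.2 h₁]
  have e2 : f m n = ⨆ k ∈ ({n', n} : Set N), f m k := by
    rw [← hf.sSup_right, sSup_pair, sup_eq_right.2 h₂]
  calc f m' n' ≤ f m n' := by
        rw [e1]; exact le_iSup₂ (f := fun k (_ : k ∈ ({m', m} : Set M)) => f k n') m' (by simp)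
    _ ≤ f m n := by
        rw [e2]; exact le_iSup₂ (f := fun k (_ : k ∈ ({n', n} : Set N)) => f m k) n' (by simp)

theorem mem_adj (hf : IsBimorphism A f) {m : M} {n : N} {c : L} :
    (m, n) ∈ adj A f c ↔ f m n ≤ c := by
  constructor
  · intro h
    let E : Tensor A M N :=
      { carrier := {x | f x.1 x.2 ≤ c}
        lower := fun h₁ h₂ h => (hf.mono h₁ h₂).trans h
        sSup_left := fun S n h => by
          simp only [Set.mem_ofPred_eq, hf.sSup_left] at h ⊢
          exact iSup₂_le h
        sSup_right := fun m S h => by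
          simp only [Set.mem_ofPred_eq, hf.sSup_right] at h ⊢
          exact iSup₂_le h
        balanced := fun m a n => by simp only [Set.mem_ofPred_eq, hf.balanced] }
    have hE : adj A f c ≤ E := sSup_le (by
      rintro _ ⟨m, n, h, rfl⟩
      exact tmul_le.2 h)
    exact hE h
  · intro h
    exact tmul_le.1 (le_sSup ⟨m, n, h, rfl⟩)

/-- `adj A f` is the right adjoint of the map induced by `f`. -/
theorem gc (hf : IsBimorphism A f) : GaloisConnection (lift (A := A) f) (adj A f) := by
  intro D c
  constructor
  · intro h x hx
    exact hf.mem_adj.2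
      ((le_iSup₂ (f := fun (x : M × N) (_ : x ∈ D) => f x.1 x.2) x hx).trans h)
  · intro h
    exact iSup₂_le fun x hx => hf.mem_adj.1 (h hx)

theorem lift_tmul (hf : IsBimorphism A f) (m : M) (n : N) : lift f (tmul A m n) = f m n :=
  eq_of_forall_ge_iff fun c => by rw [hf.gc.le_iff_le, tmul_le, hf.mem_adj]

/-- The universal property of the tensor product of sup-lattices over `A`. -/
theorem existsUnique_lift (hf : IsBimorphism A f) :
    ∃! φ : sSupHom (Tensor A M N) L, ∀ m n, φ (tmul A m n) = f m n := by
  refine ⟨⟨lift f, fun S => by rw [hf.gc.l_sSup, sSup_image]⟩, hf.lift_tmul, ?_⟩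
  intro φ hφ
  ext D
  change φ D = lift f D
  conv_lhs => rw [eq_sSup_tmul D]
  simp only [map_iSup, hφ]
  rfl

end IsBimorphism

/-- The canonical map `M × N → M ⊗_A N` is a bimorphism. -/
theorem isBimorphism_tmul :
    IsBimorphism A (fun (m : M) (n : N) => tmul A m n) where
  sSup_left S n := le_antisymm
    (tmul_le.2 (Tensor.sSup_left _ S n fun _ hm => tmul_le.1
      (le_iSup₂ (f := fun m (_ : m ∈ S) => tmul A m n) _ hm)))
    (iSup₂_le fun _ hm => tmul_le.2
      (Tensor.lower _ (le_sSup hm) le_rfl (mem_tmul _ _)))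
  sSup_right m S := le_antisymm
    (tmul_le.2 (Tensor.sSup_right _ m S fun _ hn => tmul_le.1
      (le_iSup₂ (f := fun n (_ : n ∈ S) => tmul A m n) _ hn)))
    (iSup₂_le fun _ hn => tmul_le.2
      (Tensor.lower _ le_rfl (le_sSup hn) (mem_tmul _ _)))
  balanced _ _ _ := le_antisymm
    (tmul_le.2 ((Tensor.balanced _ _ _ _).2 (mem_tmul _ _)))
    (tmul_le.2 ((Tensor.balanced _ _ _ _).1 (mem_tmul _ _)))

end SupLattice

section Locale

variable {A M N : Type u} [Order.Frame A] [Order.Frame M] [Order.Frame N]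
  [RightAModule A M] [LeftAModule A N] [RightLocalic A M] [LeftLocalic A N]

/-- The elements `x` of `M × N` whose meet with `y` lies in `C`. -/
def slice (y : M × N) (C : Tensor A M N) : Tensor A M N where
  carrier := {x | (x.1 ⊓ y.1, x.2 ⊓ y.2) ∈ C}
  lower h₁ h₂ h := C.lower (inf_le_inf_right _ h₁) (inf_le_inf_right _ h₂) h
  sSup_left S n h := by
    change (sSup S ⊓ y.1, n ⊓ y.2) ∈ C
    rw [sSup_inf_eq, ← sSup_image]
    apply C.sSup_left
    rintro _ ⟨m, hm, rfl⟩
    exact h m hm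
  sSup_right m S h := by
    change (m ⊓ y.1, sSup S ⊓ y.2) ∈ C
    rw [sSup_inf_eq, ← sSup_image]
    apply C.sSup_right
    rintro _ ⟨n, hn, rfl⟩
    exact h n hn
  balanced m a n := by
    change ((m ↼ a) ⊓ y.1, n ⊓ y.2) ∈ C ↔ (m ⊓ y.1, (a ⇀ n) ⊓ y.2) ∈ C
    rw [LeftLocalic.lres_inf, inf_comm, RightLocalic.inf_rres, inf_comm y.1]
    exact C.balanced _ _ _

/-- The Heyting implication of `M ⊗_A N`. -/
def imp (D C : Tensor A M N) : Tensor A M N :=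
  sInf {E | ∃ y ∈ D, E = slice y C}

theorem mem_imp {D C : Tensor A M N} {x : M × N} :
    x ∈ imp D C ↔ ∀ y ∈ D, (x.1 ⊓ y.1, x.2 ⊓ y.2) ∈ C :=
  ⟨fun h y hy => h _ ⟨y, hy, rfl⟩, by rintro h _ ⟨y, hy, rfl⟩; exact h y hy⟩

theorem le_imp_iff (E D C : Tensor A M N) : E ≤ imp D C ↔ E ⊓ D ≤ C := by
  constructor
  · intro h x hx
    have := mem_imp.1 (h hx.1) x hx.2
    rwa [inf_idem, inf_idem] at this
  · intro h x hx
    exact mem_imp.2 fun y hy =>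
      h ⟨E.lower inf_le_left inf_le_left hx, D.lower inf_le_right inf_le_right hy⟩

/-- If `M` and `N` are locales and the actions of `A` are compatible with meets, then `M ⊗_A N` is
a locale. -/
instance : Order.Frame (Tensor A M N) :=
  { (inferInstance : CompleteLattice (Tensor A M N)) with
    himp := imp
    le_himp_iff := fun E D C => le_imp_iff E D C
    compl := fun D => imp D ⊥
    himp_bot := fun _ => rfl }

theorem tmul_inf_tmul (m m' : M) (n n' : N) :
    tmul A m n ⊓ tmul A m' n' = tmul A (m ⊓ m') (n ⊓ n') := by
  apply le_antisymm
  · rw [← le_imp_iff, tmul_le, mem_imp]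
    intro y hy
    have h : tmul A m' n' ≤ slice (m, n) (tmul A (m ⊓ m') (n ⊓ n')) := by
      rw [tmul_le]
      change (m' ⊓ m, n' ⊓ n) ∈ tmul A (m ⊓ m') (n ⊓ n')
      rw [inf_comm m', inf_comm n']
      exact mem_tmul _ _
    have : (y.1 ⊓ m, y.2 ⊓ n) ∈ tmul A (m ⊓ m') (n ⊓ n') := h hy
    rwa [inf_comm y.1, inf_comm y.2] at this
  · exact tmul_le.2 ⟨Tensor.lower _ inf_le_left inf_le_left (mem_tmul _ _),
      Tensor.lower _ inf_le_right inf_le_right (mem_tmul _ _)⟩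

theorem tmul_top_top {A M N : Type u} [Order.Frame A] [CompleteLattice M] [CompleteLattice N]
    [RightAModule A M] [LeftAModule A N] : tmul A (⊤ : M) (⊤ : N) = ⊤ :=
  top_le_iff.1 fun _ _ => Tensor.lower _ le_top le_top (mem_tmul _ _)

/-- The frame homomorphism `m ↦ m ⊗ 1`. -/
def inl (A M N : Type u) [Order.Frame A] [Order.Frame M] [Order.Frame N]
    [RightAModule A M] [LeftAModule A N] [RightLocalic A M] [LeftLocalic A N] :
    FrameHom M (Tensor A M N) where
  toFun m := tmul A m ⊤
  map_inf' m m' := by rw [tmul_inf_tmul, inf_idem]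
  map_top' := tmul_top_top
  map_sSup' S := by rw [isBimorphism_tmul.sSup_left, sSup_image]

/-- The frame homomorphism `n ↦ 1 ⊗ n`. -/
def inr (A M N : Type u) [Order.Frame A] [Order.Frame M] [Order.Frame N]
    [RightAModule A M] [LeftAModule A N] [RightLocalic A M] [LeftLocalic A N] :
    FrameHom N (Tensor A M N) where
  toFun n := tmul A ⊤ n
  map_inf' n n' := by rw [tmul_inf_tmul, inf_idem]
  map_top' := tmul_top_top
  map_sSup' S := by rw [isBimorphism_tmul.sSup_right, sSup_image]

/-- `M ⊗_A N`, as a locale. -/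
abbrev prod (A M N : Type u) [Order.Frame A] [Order.Frame M] [Order.Frame N]
    [RightAModule A M] [LeftAModule A N] [RightLocalic A M] [LeftLocalic A N] : Locale.{u} :=
  Locale.of (Tensor A M N)

/-- The first projection of the locale `M ⊗_A N`. -/
def proj₁ (A M N : Type u) [Order.Frame A] [Order.Frame M] [Order.Frame N]
    [RightAModule A M] [LeftAModule A N] [RightLocalic A M] [LeftLocalic A N] :
    prod A M N ⟶ Locale.of M :=
  mapOf (inl A M N)

/-- The second projection of the locale `M ⊗_A N`. -/
def proj₂ (A M N : Type u) [Order.Frame A] [Order.Frame M] [Order.Frame N]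
    [RightAModule A M] [LeftAModule A N] [RightLocalic A M] [LeftLocalic A N] :
    prod A M N ⟶ Locale.of N :=
  mapOf (inr A M N)

theorem isBimorphism_inf {T : Type u} [Order.Frame T] (g : FrameHom M T) (h : FrameHom N T)
    (w : ∀ a : A, g (⊤ ↼ a) = h (a ⇀ ⊤)) : IsBimorphism A (fun m n => g m ⊓ h n) where
  sSup_left S n := by rw [map_sSup, sSup_inf_eq, iSup_image]
  sSup_right m S := by rw [map_sSup, inf_sSup_eq, iSup_image]
  balanced m a n := by
    have e1 : m ↼ a = m ⊓ (⊤ ↼ a) := by rw [RightLocalic.inf_rres, inf_top_eq]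
    have e2 : a ⇀ n = (a ⇀ ⊤) ⊓ n := by rw [LeftLocalic.lres_inf, top_inf_eq]
    rw [e1, e2, map_inf, map_inf, w, inf_assoc]

/-- The frame homomorphism on `M ⊗_A N` induced by a pair of frame homomorphisms. -/
def pair {T : Type u} [Order.Frame T] (g : FrameHom M T) (h : FrameHom N T)
    (w : ∀ a : A, g (⊤ ↼ a) = h (a ⇀ ⊤)) : FrameHom (Tensor A M N) T where
  toFun := lift fun m n => g m ⊓ h n
  map_sSup' S := by rw [(isBimorphism_inf g h w).gc.l_sSup, sSup_image]
  map_top' := by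
    rw [← tmul_top_top, (isBimorphism_inf g h w).lift_tmul, map_top, map_top, inf_top_eq]
  map_inf' D E := by
    apply le_antisymm
    · exact (isBimorphism_inf g h w).gc.monotone_l.map_inf_le D E
    · unfold lift
      simp only [iSup_inf_eq, inf_iSup_eq]
      refine iSup₂_le fun x hx => iSup₂_le fun y hy => ?_
      have hxy : (y.1 ⊓ x.1, y.2 ⊓ x.2) ∈ D ⊓ E := by
        constructor <;> first
          | exact Tensor.lower _ inf_le_left inf_le_left (by assumption)
          | exact Tensor.lower _ inf_le_right inf_le_right (by assumption)
      refine le_trans (le_of_eq ?_) (le_iSup₂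
        (f := fun (z : M × N) (_ : z ∈ D ⊓ E) => g z.1 ⊓ h z.2) _ hxy)
      rw [map_inf, map_inf]
      exact inf_inf_inf_comm _ _ _ _

theorem pair_apply {T : Type u} [Order.Frame T] (g : FrameHom M T) (h : FrameHom N T)
    (w : ∀ a : A, g (⊤ ↼ a) = h (a ⇀ ⊤)) (D : Tensor A M N) :
    pair g h w D = ⨆ x ∈ D, g x.1 ⊓ h x.2 := rfl

theorem pair_tmul {T : Type u} [Order.Frame T] (g : FrameHom M T) (h : FrameHom N T)
    (w : ∀ a : A, g (⊤ ↼ a) = h (a ⇀ ⊤)) (m : M) (n : N) :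
    pair g h w (tmul A m n) = g m ⊓ h n :=
  (isBimorphism_inf g h w).lift_tmul m n

theorem hom_eq_pair {T : Type u} [Order.Frame T] (g : FrameHom M T) (h : FrameHom N T)
    (k : FrameHom (Tensor A M N) T)
    (hg : ∀ m, k (inl A M N m) = g m) (hh : ∀ n, k (inr A M N n) = h n) (D : Tensor A M N) :
    k D = ⨆ x ∈ D, g x.1 ⊓ h x.2 := by
  conv_lhs => rw [eq_sSup_tmul D]
  rw [map_iSup]
  simp only [map_iSup]
  refine iSup_congr fun x => iSup_congr fun _ => ?_
  have : tmul A x.1 x.2 = inl A M N x.1 ⊓ inr A M N x.2 := by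
    change _ = tmul A x.1 ⊤ ⊓ tmul A ⊤ x.2
    rw [tmul_inf_tmul, inf_top_eq, top_inf_eq]
  rw [this, map_inf, hg, hh]

theorem frameHom_eq {A M N : Type u} [Order.Frame A] [Order.Frame M] [Order.Frame N]
    {T : Locale.{u}} {f : Locale.of M ⟶ Locale.of A}
    {p : Locale.of N ⟶ Locale.of A} {r : FrameHom A M} {q : FrameHom A N} (hf : f = mapOf r)
    (hp : p = mapOf q) (g : T ⟶ Locale.of M) (k : T ⟶ Locale.of N) (w : g ≫ f = k ≫ p) (a : A) :
    frameHom g (r a) = frameHom k (q a) := by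
  subst hf hp
  exact congrArg (fun φ : T ⟶ Locale.of A => frameHom φ a) w

/-- `M ⊗_A N` is the pullback of locales of `M` and `N` over `A`, if the maps to `A` have the
inverse images `a ↦ 1 ↼ a` and `a ↦ a ⇀ 1`. -/
theorem isPullback {r : FrameHom A M} {q : FrameHom A N}
    (hr : ∀ a : A, r a = (⊤ : M) ↼ a) (hq : ∀ a : A, q a = a ⇀ (⊤ : N)) :
    IsPullback (proj₁ A M N) (proj₂ A M N) (mapOf r) (mapOf q) := by
  have key : ∀ (T : Locale.{u}) (g : T ⟶ Locale.of M) (k : T ⟶ Locale.of N),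
      g ≫ mapOf r = k ≫ mapOf q →
      ∀ a : A, frameHom g ((⊤ : M) ↼ a) = frameHom k (a ⇀ (⊤ : N)) := by
    intro T g k w a
    rw [← hr, ← hq]
    exact frameHom_eq rfl rfl g k w a
  refine ⟨⟨map_ext fun (a : A) => ?_⟩, ⟨Limits.PullbackCone.IsLimit.mk _
    (fun s => Quiver.Hom.op (Frm.ofHom (pair (frameHom s.fst)
      (frameHom s.snd) (key _ _ _ s.condition))))
    (fun s => ?_) (fun s => ?_) (fun s k h₁ h₂ => ?_)⟩⟩
  · change inl A M N (r a) = inr A M N (q a)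
    rw [hr, hq]
    exact isBimorphism_tmul.balanced _ _ _
  · refine map_ext fun (m : M) => ?_
    refine (pair_tmul _ _ (key _ _ _ s.condition) m ⊤).trans ?_
    exact (congrArg _ (map_top _)).trans (inf_top_eq _)
  · refine map_ext fun (n : N) => ?_
    refine (pair_tmul _ _ (key _ _ _ s.condition) ⊤ n).trans ?_
    exact (congrArg (· ⊓ _) (map_top _)).trans (top_inf_eq _)
  · refine map_ext fun (D : Tensor A M N) => ?_
    refine hom_eq_pair (frameHom s.fst) (frameHom s.snd) (frameHom k) (fun m => ?_) (fun n => ?_) D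
    · rw [← h₁]; rfl
    · rw [← h₂]; rfl

theorem frameHom_lift {f : Locale.of M ⟶ Locale.of A} {p : Locale.of N ⟶ Locale.of A}
    (h : IsPullback (proj₁ A M N) (proj₂ A M N) f p) {T : Locale.{u}}
    (g : T ⟶ Locale.of M) (k : T ⟶ Locale.of N) (w : g ≫ f = k ≫ p) (D : Tensor A M N) :
    frameHom (h.lift g k w) D = ⨆ x ∈ D, frameHom g x.1 ⊓ frameHom k x.2 := by
  refine hom_eq_pair (frameHom g) (frameHom k) (frameHom (h.lift g k w))
    (fun m => ?_) (fun n => ?_) D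
  · conv_rhs => rw [← h.lift_fst g k w]
    rfl
  · conv_rhs => rw [← h.lift_snd g k w]
    rfl

theorem frameHom_lift_comp {f : Locale.of M ⟶ Locale.of A} {p : Locale.of N ⟶ Locale.of A}
    (h : IsPullback (proj₁ A M N) (proj₂ A M N) f p) {T : Locale.{u}} {L : Type u} [Order.Frame L]
    (g : T ⟶ Locale.of M) (k : T ⟶ Locale.of N) (w : g ≫ f = k ≫ p)
    {act : M → N → L} (hact : IsBimorphism A act) {μ : FrameHom L (Tensor A M N)}
    (hμ : ∀ c, μ c = adj A act c) (c : L) :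
    frameHom (h.lift g k w ≫ mapOf μ) c =
      ⨆ (m : M) (n : N) (_ : act m n ≤ c), frameHom g m ⊓ frameHom k n := by
  have e : frameHom (h.lift g k w ≫ mapOf μ) c = frameHom (h.lift g k w) (μ c) := rfl
  rw [e, frameHom_lift, hμ, iSup_prod]
  simp only [hact.mem_adj]

end Locale

end Tensor

/-- The frame homomorphism `A → M`, `a ↦ a ⇀ 1`. -/
def lresTop (A M : Type u) [Order.Frame A] [Order.Frame M] [LeftAModule A M] [LeftLocalic A M] :
    FrameHom A M where
  toFun a := a ⇀ ⊤
  map_inf' a b := by rw [LeftLocalic.lres_inf, top_inf_eq, LeftAModule.inf_lres]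
  map_top' := LeftAModule.top_lres _
  map_sSup' S := by rw [LeftAModule.sSup_lres, sSup_image]

/-- The frame homomorphism `A → M`, `a ↦ 1 ↼ a`. -/
def topRres (A M : Type u) [Order.Frame A] [Order.Frame M] [RightAModule A M] [RightLocalic A M] :
    FrameHom A M where
  toFun a := ⊤ ↼ a
  map_inf' a b := by rw [RightLocalic.inf_rres, inf_top_eq, RightAModule.rres_inf]
  map_top' := RightAModule.rres_top _
  map_sSup' S := by rw [RightAModule.rres_sSup, sSup_image]

/-! ## Groupoid quantales -/

/-- A based quantale: an involutive quantale `Q` (Mathlib's `Semigroup`, `IsQuantale`, `StarMul`)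
with the structure of an involutive `A`-`A`-quantale for a locale `A`. -/
class BasedQuantale (A Q : Type u) [Order.Frame A] [CompleteLattice Q] [Semigroup Q] [IsQuantale Q]
    [StarMul Q] extends LeftAModule A Q, RightAModule A Q where
  lres_rres : ∀ (a b : A) (x : Q), (a ⇀ x) ↼ b = a ⇀ (x ↼ b)
  lres_mul : ∀ (a : A) (x y : Q), (a ⇀ x) * y = a ⇀ (x * y)
  rres_mul : ∀ (a : A) (x y : Q), (x ↼ a) * y = x * (a ⇀ y)
  mul_rres : ∀ (a : A) (x y : Q), (x * y) ↼ a = x * (y ↼ a)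
  star_sSup : ∀ S : Set Q, star (sSup S) = ⨆ x ∈ S, star x
  star_lres_rres : ∀ (a b : A) (x : Q), star (a ⇀ (x ↼ b)) = b ⇀ (star x ↼ a)

/-- A supported quantale, with support `spp : Q → A`. -/
class SupportedQuantale (A Q : Type u) [Order.Frame A] [CompleteLattice Q] [Semigroup Q]
    [IsQuantale Q] [StarMul Q] extends BasedQuantale A Q where
  spp : Q → A
  spp_sSup : ∀ S : Set Q, spp (sSup S) = ⨆ x ∈ S, spp x
  spp_top : spp ⊤ = ⊤
  spp_lres_le : ∀ x y : Q, spp x ⇀ y ≤ x * star x * y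
  spp_lres_self : ∀ x : Q, spp x ⇀ x = x

/-- A groupoid quantale: a multiplicative, equivariantly supported, reflexive quantal frame
satisfying the unit laws and the inverse laws. The parents `LeftLocalic` and `RightLocalic`,
together with the frame structure of `Q`, make the based quantale `Q` a quantal frame. -/
class GroupoidQuantale (A Q : Type u) [Order.Frame A] [Order.Frame Q] [Semigroup Q] [IsQuantale Q]
    [StarMul Q] extends SupportedQuantale A Q, LeftLocalic A Q, RightLocalic A Q where
  /-- equivariance of the support -/
  spp_lres : ∀ (a : A) (x : Q), spp (a ⇀ x) = a ⊓ spp x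
  /-- the frame homomorphism that makes `Q` reflexive -/
  υ : FrameHom Q A
  υ_lres_top : ∀ a : A, υ (a ⇀ (⊤ : Q)) = a
  υ_top_rres : ∀ a : A, υ ((⊤ : Q) ↼ a) = a
  /-- multiplicativity: the right adjoint of the multiplication `Q ⊗_A Q → Q` preserves joins -/
  multiplicative : ∀ S : Set Q,
    Tensor.adj A (fun x y : Q => x * y) (sSup S) = ⨆ a ∈ S, Tensor.adj A (fun x y : Q => x * y) a
  unit_laws : ∀ a : Q, ⨆ (x : Q) (y : Q) (_ : x * y ≤ a), υ x ⇀ y = a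
  inverse_laws : ∀ a : Q, υ a ⇀ (⊤ : Q) = ⨆ (x : Q) (_ : x * star x ≤ a), x

section GroupoidOf

open Tensor SupportedQuantale GroupoidQuantale BasedQuantale LeftAModule RightAModule LeftLocalic
  RightLocalic

variable {A Q : Type u} [Order.Frame A] [Order.Frame Q] [Semigroup Q] [IsQuantale Q] [StarMul Q]
  [GroupoidQuantale A Q]

theorem isBimorphism_mul (A Q : Type u) [Order.Frame A] [Order.Frame Q] [Semigroup Q]
    [IsQuantale Q] [StarMul Q] [GroupoidQuantale A Q] :
    IsBimorphism A (fun x y : Q => x * y) where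
  sSup_left _ _ := sSup_mul_distrib
  sSup_right _ _ := mul_sSup_distrib
  balanced x a y := rres_mul a x y

theorem star_mono {x y : Q} (A : Type u) [Order.Frame A] [GroupoidQuantale A Q] (h : x ≤ y) :
    star x ≤ star y := by
  have : star y = ⨆ z ∈ ({x, y} : Set Q), star z := by
    rw [← star_sSup (A := A), sSup_pair, sup_eq_right.2 h]
  rw [this]
  exact le_iSup₂ (f := fun z (_ : z ∈ ({x, y} : Set Q)) => star z) x (by simp)

/-- The involution of `Q` as a frame homomorphism. -/
def starHom (A Q : Type u) [Order.Frame A] [Order.Frame Q] [Semigroup Q] [IsQuantale Q] [StarMul Q]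
    [GroupoidQuantale A Q] : FrameHom Q Q where
  toFun := star
  map_inf' x y := by
    apply le_antisymm
    · exact le_inf (star_mono A inf_le_left) (star_mono A inf_le_right)
    · have : star (star x ⊓ star y) ≤ x ⊓ y := le_inf
        ((star_mono A inf_le_left).trans (star_star x).le)
        ((star_mono A inf_le_right).trans (star_star y).le)
      have h := star_mono A this
      rwa [star_star] at h
  map_top' := by
    apply top_le_iff.1
    have h := star_mono A (le_top (a := star (⊤ : Q)))
    rwa [star_star] at h
  map_sSup' S := by rw [star_sSup (A := A), sSup_image]

/-- The right adjoint of the multiplication `Q ⊗_A Q → Q`, as a frame homomorphism. -/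
def comulHom (A Q : Type u) [Order.Frame A] [Order.Frame Q] [Semigroup Q] [IsQuantale Q]
    [StarMul Q] [GroupoidQuantale A Q] : FrameHom Q (Tensor A Q Q) where
  toFun := adj A fun x y : Q => x * y
  map_inf' _ _ := (isBimorphism_mul A Q).gc.u_inf
  map_top' := (isBimorphism_mul A Q).gc.u_top
  map_sSup' S := by rw [multiplicative, sSup_image]

theorem lres_mono {A M : Type u} [Order.Frame A] [CompleteLattice M] [LeftAModule A M]
    {a b : A} {m n : M} (h₁ : a ≤ b) (h₂ : m ≤ n) : a ⇀ m ≤ b ⇀ n := by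
  have e1 : b ⇀ m = ⨆ c ∈ ({a, b} : Set A), c ⇀ m := by
    rw [← sSup_lres, sSup_pair, sup_eq_right.2 h₁]
  have e2 : b ⇀ n = ⨆ k ∈ ({m, n} : Set M), b ⇀ k := by
    rw [← lres_sSup, sSup_pair, sup_eq_right.2 h₂]
  calc a ⇀ m ≤ b ⇀ m := by
        rw [e1]; exact le_iSup₂ (f := fun k (_ : k ∈ ({a, b} : Set A)) => k ⇀ m) a (by simp)
    _ ≤ b ⇀ n := by
        rw [e2]; exact le_iSup₂ (f := fun k (_ : k ∈ ({m, n} : Set M)) => b ⇀ k) m (by simp)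

theorem lres_top_inf {A M : Type u} [Order.Frame A] [Order.Frame M] [LeftAModule A M]
    [LeftLocalic A M] (a : A) (m : M) : (a ⇀ ⊤) ⊓ m = a ⇀ m := by
  rw [lres_inf, top_inf_eq]

theorem inf_top_rres {A M : Type u} [Order.Frame A] [Order.Frame M] [RightAModule A M]
    [RightLocalic A M] (a : A) (m : M) : m ⊓ (⊤ ↼ a) = m ↼ a := by
  rw [inf_rres, inf_top_eq]

theorem spp_mono {x y : Q} (A : Type u) [Order.Frame A] [GroupoidQuantale A Q] (h : x ≤ y) :
    (spp x : A) ≤ spp y := by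
  have : (spp y : A) = ⨆ z ∈ ({x, y} : Set Q), spp z := by
    rw [← spp_sSup, sSup_pair, sup_eq_right.2 h]
  rw [this]
  exact le_iSup₂ (f := fun z (_ : z ∈ ({x, y} : Set Q)) => (spp z : A)) x (by simp)

theorem le_lres_top_iff (x : Q) (a : A) : x ≤ a ⇀ (⊤ : Q) ↔ spp x ≤ a := by
  constructor
  · intro h
    refine (spp_mono A h).trans ?_
    rw [spp_lres]
    exact inf_le_left
  · intro h
    rw [← spp_lres_self (A := A) x]
    exact lres_mono h le_top

theorem spp_mul_le (x y : Q) : (spp (x * y) : A) ≤ spp x := by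
  have h : x * y = (spp x : A) ⇀ (x * y) := by rw [← lres_mul, spp_lres_self]
  rw [h, spp_lres]
  exact inf_le_left

theorem spp_rres_le (x y : Q) : (spp (x ↼ (spp y : A)) : A) ≤ spp (x * y) := by
  have hm := isBimorphism_mul A Q
  have h1 : ∀ z : Q, z ≤ z * ⊤ := fun z => by
    conv_lhs => rw [← spp_lres_self (A := A) z]
    refine (spp_lres_le z z).trans ?_
    rw [mul_assoc]
    exact hm.mono le_rfl le_top
  have h2 : (x ↼ (spp y : A)) * ⊤ ≤ x * y * ⊤ := by
    rw [rres_mul, mul_assoc]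
    refine hm.mono le_rfl ((spp_lres_le y ⊤).trans ?_)
    rw [mul_assoc]
    exact hm.mono le_rfl le_top
  exact (spp_mono A (h1 _)).trans ((spp_mono A h2).trans (spp_mul_le _ _))

theorem star_lres (a : A) (x : Q) : star (a ⇀ x) = star x ↼ a := by
  have := star_lres_rres a ⊤ x
  rwa [rres_top, top_lres] at this

theorem star_rres (a : A) (x : Q) : star (x ↼ a) = a ⇀ star x := by
  have := star_lres_rres ⊤ a x
  rwa [rres_top, top_lres] at this

theorem star_le_iff (A : Type u) [Order.Frame A] [GroupoidQuantale A Q] {x y : Q} :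
    star x ≤ y ↔ x ≤ star y :=
  ⟨fun h => by simpa using star_mono A h, fun h => by simpa using star_mono A h⟩

theorem comul_lres_top (a : A) : comulHom A Q (a ⇀ ⊤) = inl A Q Q (a ⇀ ⊤) := by
  have hm := isBimorphism_mul A Q
  apply le_antisymm
  · rintro ⟨x, y⟩ h
    have h1 : x * y ≤ a ⇀ (⊤ : Q) := hm.mem_adj.1 h
    have h2 : x ↼ (spp y : A) ≤ a ⇀ (⊤ : Q) :=
      (le_lres_top_iff _ _).2 ((spp_rres_le x y).trans ((le_lres_top_iff _ _).1 h1))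
    have h3 : (x ↼ (spp y : A), y) ∈ inl A Q Q (a ⇀ ⊤) :=
      Tensor.lower _ h2 le_top (mem_tmul _ _)
    have h4 := (Tensor.balanced _ _ _ _).1 h3
    rwa [spp_lres_self] at h4
  · refine tmul_le.2 (hm.mem_adj.2 ?_)
    rw [lres_mul]
    exact lres_mono le_rfl le_top

theorem comul_top_rres (a : A) : comulHom A Q (⊤ ↼ a) = inr A Q Q (⊤ ↼ a) := by
  have hm := isBimorphism_mul A Q
  have ht : star (⊤ : Q) = ⊤ := map_top (starHom A Q)
  apply le_antisymm
  · rintro ⟨x, y⟩ h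
    have h1 : x * y ≤ (⊤ : Q) ↼ a := hm.mem_adj.1 h
    have h1' : star y * star x ≤ a ⇀ (⊤ : Q) := by
      rw [← star_mul, star_le_iff A, star_lres, ht]
      exact h1
    have h2 : star y ↼ (spp (star x) : A) ≤ a ⇀ (⊤ : Q) :=
      (le_lres_top_iff _ _).2 ((spp_rres_le _ _).trans ((le_lres_top_iff _ _).1 h1'))
    have h2' : (spp (star x) : A) ⇀ y ≤ (⊤ : Q) ↼ a := by
      have h := star_mono A h2
      rwa [star_rres, star_star, star_lres, ht] at h
    have h3 : (x, (spp (star x) : A) ⇀ y) ∈ inr A Q Q (⊤ ↼ a) :=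
      Tensor.lower _ le_top h2' (mem_tmul _ _)
    have h4 := (Tensor.balanced _ _ _ _).2 h3
    have h5 : x ↼ (spp (star x) : A) = x := by
      have h := congrArg star (spp_lres_self (A := A) (star x))
      rwa [star_lres, star_star] at h
    rwa [h5] at h4
  · refine tmul_le.2 (hm.mem_adj.2 ?_)
    rw [← mul_rres, ← inf_top_rres]
    exact inf_le_right

theorem rightUnit_aux (q : Q) :
    ⨆ (x : Q) (y : Q) (_ : x * y ≤ q), x ↼ (υ (star y) : A) = q := by
  have h := congrArg (starHom A Q) (unit_laws (A := A) (star q))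
  simp only [map_iSup] at h
  have e : ∀ x y : Q, starHom A Q ((υ x : A) ⇀ y) = star y ↼ (υ x : A) := fun x y => star_lres _ _
  have e' : starHom A Q (star q) = q := star_star q
  simp only [e, e'] at h
  conv_rhs => rw [← h]
  apply le_antisymm
  · refine iSup_le fun x => iSup_le fun y => iSup_le fun h => ?_
    refine le_iSup_of_le (star y) (le_iSup_of_le (star x) (le_iSup_of_le ?_ ?_))
    · rw [← star_mul]; exact star_mono A h
    · rw [star_star]
  · refine iSup_le fun x => iSup_le fun y => iSup_le fun h => ?_
    refine le_iSup_of_le (star y) (le_iSup_of_le (star x) (le_iSup_of_le ?_ ?_))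
    · rw [← star_mul, star_le_iff A]; exact h
    · rw [star_star]

theorem υ_lres (a : A) (x : Q) : (υ (a ⇀ x) : A) = a ⊓ υ x := by
  rw [← lres_top_inf, map_inf, υ_lres_top]

theorem υ_rres (a : A) (x : Q) : (υ (x ↼ a) : A) = υ x ⊓ a := by
  rw [← inf_top_rres, map_inf, υ_top_rres]

theorem υ_star (q : Q) : (υ (star q) : A) = υ q := by
  have h1 : (υ (star q) : A) = ⨆ (x : Q) (y : Q) (_ : x * y ≤ q), υ x ⊓ υ (star y) := by
    have h := congrArg (fun z => (υ (starHom A Q z) : A)) (unit_laws (A := A) q)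
    simp only [map_iSup] at h
    refine Eq.trans h.symm ?_
    refine iSup_congr fun x => iSup_congr fun y => iSup_congr fun _ => ?_
    refine (congrArg (υ : FrameHom Q A) (star_lres _ _)).trans ?_
    rw [υ_rres, inf_comm]
  have h2 : (υ q : A) = ⨆ (x : Q) (y : Q) (_ : x * y ≤ q), υ x ⊓ υ (star y) := by
    have h := congrArg (υ : FrameHom Q A) (rightUnit_aux (A := A) q)
    simp only [map_iSup, υ_rres] at h
    exact h.symm
  rw [h1, h2]

theorem rightUnit (q : Q) :
    ⨆ (x : Q) (y : Q) (_ : x * y ≤ q), x ⊓ ((⊤ : Q) ↼ (υ y : A)) = q := by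
  simpa only [υ_star, inf_top_rres] using rightUnit_aux (A := A) q

theorem leftUnit (q : Q) :
    ⨆ (x : Q) (y : Q) (_ : x * y ≤ q), ((υ x : A) ⇀ (⊤ : Q)) ⊓ y = q := by
  simpa only [lres_top_inf] using unit_laws (A := A) q

theorem star_lres_top (a : A) : star (a ⇀ (⊤ : Q)) = ⊤ ↼ a :=
  (star_lres a ⊤).trans (congrArg (· ↼ a) (map_top (starHom A Q)))

theorem star_top_rres (a : A) : star ((⊤ : Q) ↼ a) = a ⇀ ⊤ :=
  (star_rres a ⊤).trans (congrArg (a ⇀ ·) (map_top (starHom A Q)))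

theorem mulInv (q : Q) :
    ⨆ (x : Q) (y : Q) (_ : x * y ≤ q), x ⊓ star y = (υ q : A) ⇀ (⊤ : Q) := by
  have hm := isBimorphism_mul A Q
  rw [inverse_laws]
  apply le_antisymm
  · refine iSup_le fun x => iSup_le fun y => iSup_le fun h => ?_
    refine le_iSup₂_of_le (x ⊓ star y) ?_ le_rfl
    exact (hm.mono inf_le_left ((star_le_iff A).2 inf_le_right)).trans h
  · refine iSup₂_le fun x h => ?_
    refine le_iSup_of_le x (le_iSup_of_le (star x) (le_iSup_of_le h ?_))
    rw [star_star, inf_idem]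

theorem invMul (q : Q) :
    ⨆ (x : Q) (y : Q) (_ : x * y ≤ q), star x ⊓ y = (⊤ : Q) ↼ (υ q : A) := by
  have hm := isBimorphism_mul A Q
  have ht : star (⊤ : Q) = ⊤ := map_top (starHom A Q)
  have e : (⊤ : Q) ↼ (υ q : A) = star ((υ q : A) ⇀ (⊤ : Q)) := by rw [star_lres, ht]
  apply le_antisymm
  · refine iSup_le fun x => iSup_le fun y => iSup_le fun h => ?_
    rw [e, ← star_le_iff A, inverse_laws]
    refine le_iSup₂_of_le (star (star x ⊓ y)) ?_ le_rfl
    rw [star_star]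
    exact (hm.mono ((star_le_iff A).2 inf_le_left) inf_le_right).trans h
  · rw [e, star_le_iff A, inverse_laws]
    refine iSup₂_le fun x h => ?_
    rw [← star_le_iff A]
    refine le_iSup_of_le x (le_iSup_of_le (star x) (le_iSup_of_le h ?_))
    rw [inf_idem]

theorem assoc_aux {Q N T : Type u} [CompleteLattice Q] [Semigroup Q] [CompleteLattice N] [Order.Frame T] (act : Q → N → N)
    (hmono : ∀ {q q' n n'}, q' ≤ q → n' ≤ n → act q' n' ≤ act q n)
    (hassoc : ∀ q q' n, act (q * q') n = act q (act q' n))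
    (g h : Q → T) (k : N → T) (c : N) :
    ⨆ (x : Q) (n : N) (_ : act x n ≤ c), (⨆ (z : Q) (w : Q) (_ : z * w ≤ x), g z ⊓ h w) ⊓ k n =
    ⨆ (x : Q) (n : N) (_ : act x n ≤ c), g x ⊓ ⨆ (z : Q) (w : N) (_ : act z w ≤ n), h z ⊓ k w := by
  simp only [iSup_inf_eq, inf_iSup_eq]
  apply le_antisymm
  · refine iSup_le fun x => iSup_le fun n => iSup_le fun hc => iSup_le fun z => iSup_le fun w =>
      iSup_le fun hx => ?_
    refine le_iSup_of_le z (le_iSup_of_le (act w n) (le_iSup_of_le ?_ (le_iSup_of_le w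
      (le_iSup_of_le n (le_iSup_of_le le_rfl (inf_assoc _ _ _).le)))))
    rw [← hassoc]
    exact (hmono hx le_rfl).trans hc
  · refine iSup_le fun x => iSup_le fun n => iSup_le fun hc => iSup_le fun z => iSup_le fun w =>
      iSup_le fun hx => ?_
    refine le_iSup_of_le (x * z) (le_iSup_of_le w (le_iSup_of_le ?_ (le_iSup_of_le x
      (le_iSup_of_le z (le_iSup_of_le le_rfl (inf_assoc _ _ _).ge)))))
    rw [hassoc]
    exact (hmono le_rfl hx).trans hc

theorem lift_assoc {A Q N : Type u} [Order.Frame A] [Order.Frame Q] [Order.Frame N] [Semigroup Q]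
    [RightAModule A Q] [LeftAModule A Q] [LeftAModule A N] [RightLocalic A Q] [LeftLocalic A Q]
    [LeftLocalic A N] {act : Q → N → N}
    {f p : Locale.of Q ⟶ Locale.of A} {f' : Locale.of Q ⟶ Locale.of A}
    {p' : Locale.of N ⟶ Locale.of A}
    (hQ : IsPullback (proj₁ A Q Q) (proj₂ A Q Q) f p)
    (hN : IsPullback (proj₁ A Q N) (proj₂ A Q N) f' p')
    (hmul : IsBimorphism A (fun x y : Q => x * y)) (hact : IsBimorphism A act)
    {μ : FrameHom Q (Tensor A Q Q)} {ν : FrameHom N (Tensor A Q N)}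
    (hμ : ∀ q, μ q = adj A (fun x y : Q => x * y) q) (hν : ∀ n, ν n = adj A act n)
    (hassoc : ∀ q q' n, act (q * q') n = act q (act q' n))
    {T : Locale.{u}} (g h : T ⟶ Locale.of Q) (k : T ⟶ Locale.of N) (w₁ : g ≫ f = h ≫ p)
    (w₂ : (hQ.lift g h w₁ ≫ mapOf μ) ≫ f' = k ≫ p') (w₃ : h ≫ f' = k ≫ p')
    (w₄ : g ≫ f' = (hN.lift h k w₃ ≫ mapOf ν) ≫ p') :
    hN.lift (hQ.lift g h w₁ ≫ mapOf μ) k w₂ ≫ mapOf ν =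
      hN.lift g (hN.lift h k w₃ ≫ mapOf ν) w₄ ≫ mapOf ν := by
  refine mapOf_ext fun c => ?_
  refine (frameHom_lift_comp hN _ _ w₂ hact hν c).trans ?_
  refine Eq.trans ?_ (frameHom_lift_comp hN _ _ w₄ hact hν c).symm
  have e1 := frameHom_lift_comp hQ g h w₁ hmul hμ
  have e2 := frameHom_lift_comp hN h k w₃ hact hν
  refine Eq.trans ?_ ((assoc_aux act hact.mono hassoc (frameHom g) (frameHom h) (frameHom k)
    c).trans ?_)
  · exact iSup_congr fun x => iSup_congr fun y => iSup_congr fun _ => congrArg (· ⊓ _) (e1 x)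
  · exact iSup_congr fun x => iSup_congr fun y => iSup_congr fun _ => congrArg (_ ⊓ ·) (e2 y).symm

/-- The localic groupoid `𝒢(Q)` of a groupoid quantale `Q` over `A`: the locale of objects is
`A`, the locale of arrows is `Q`, and the inverse images of the structure maps are
`d^* a = a ⇀ 1`, `r^* a = 1 ↼ a`, `u^* = υ`, `i^* = star`, and `m^*` is the right adjoint of the
multiplication `Q ⊗_A Q → Q`. -/
def groupoidOf (A Q : Type u) [Order.Frame A] [Order.Frame Q] [Semigroup Q] [IsQuantale Q]
    [StarMul Q] [GroupoidQuantale A Q] : LocalicGroupoid.{u} where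
  obj := Locale.of A
  arr := Locale.of Q
  comp := prod A Q Q
  d := mapOf (lresTop A Q)
  r := mapOf (topRres A Q)
  unit := mapOf (υ : FrameHom Q A)
  i := mapOf (starHom A Q)
  π₁ := proj₁ A Q Q
  π₂ := proj₂ A Q Q
  m := mapOf (comulHom A Q)
  isPullback := Tensor.isPullback (fun _ => rfl) (fun _ => rfl)
  unit_d := mapOf_ext (Q := A) fun a => υ_lres_top (Q := Q) a
  unit_r := mapOf_ext (Q := A) fun a => υ_top_rres (Q := Q) a
  m_d := mapOf_ext fun a => comul_lres_top a
  m_r := mapOf_ext fun a => comul_top_rres a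
  assoc _ g h k _ _ :=
    lift_assoc _ _ (isBimorphism_mul A Q) (isBimorphism_mul A Q) (fun _ => rfl) (fun _ => rfl)
      mul_assoc g h k _ _ _ _
  unit_mul := mapOf_ext fun q =>
    (frameHom_lift_comp _ _ _ _ (isBimorphism_mul A Q) (fun _ => rfl) q).trans (leftUnit q)
  mul_unit := mapOf_ext fun q =>
    (frameHom_lift_comp _ _ _ _ (isBimorphism_mul A Q) (fun _ => rfl) q).trans (rightUnit q)
  i_d := mapOf_ext fun a => star_lres_top (A := A) (Q := Q) a
  i_r := mapOf_ext fun a => star_top_rres (A := A) (Q := Q) a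
  mul_inv := mapOf_ext fun q =>
    (frameHom_lift_comp _ _ _ _ (isBimorphism_mul A Q) (fun _ => rfl) q).trans (mulInv q)
  inv_mul := mapOf_ext fun q =>
    (frameHom_lift_comp _ _ _ _ (isBimorphism_mul A Q) (fun _ => rfl) q).trans (invMul q)

theorem groupoidOf_isOpen (A Q : Type u) [Order.Frame A] [Order.Frame Q] [Semigroup Q]
    [IsQuantale Q] [StarMul Q] [GroupoidQuantale A Q] : (groupoidOf A Q).IsOpen := by
  have gc : GaloisConnection (spp : Q → A) (lresTop A Q) := fun x a => (le_lres_top_iff x a).symm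
  have h : ∀ (x : Q) (a : A), (spp (x ⊓ (a ⇀ (⊤ : Q))) : A) = spp x ⊓ a := fun x a => by
    rw [inf_comm x, lres_top_inf, spp_lres, inf_comm]
  exact ⟨(spp : Q → A), gc, h⟩

end GroupoidOf

/-! ## Modules over groupoid quantales -/

/-- A (left) `Q`-module, for a groupoid quantale `Q` over `A`: a locale `X` with an associative left
action of `Q` (Mathlib's `SemigroupAction`, written `q • x`) that preserves joins in each variable,
and a unital left `A`-module structure (whose compatibility with meets is the parent
`LeftLocalic`). -/
class QModule (A Q X : Type u) [Order.Frame A] [Order.Frame Q] [Semigroup Q] [IsQuantale Q]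
    [StarMul Q] [GroupoidQuantale A Q] [Order.Frame X] [SemigroupAction Q X]
    extends LeftAModule A X, LeftLocalic A X where
  sSup_smul : ∀ (S : Set Q) (x : X), sSup S • x = ⨆ q ∈ S, q • x
  smul_sSup : ∀ (q : Q) (S : Set X), q • sSup S = ⨆ x ∈ S, q • x
  lres_smul : ∀ (a : A) (q : Q) (x : X), (a ⇀ q) • x = a ⇀ (q • x)
  rres_smul : ∀ (a : A) (q : Q) (x : X), (q ↼ a) • x = q • (a ⇀ x)

/-- A pre-Hilbert `Q`-module: a `Q`-module with a `Q`-valued inner product `ip`. -/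
class PreHilbertQModule (A Q X : Type u) [Order.Frame A] [Order.Frame Q] [Semigroup Q]
    [IsQuantale Q] [StarMul Q] [GroupoidQuantale A Q] [Order.Frame X] [SemigroupAction Q X]
    extends QModule A Q X where
  ip : X → X → Q
  ip_smul : ∀ (q : Q) (x y : X), ip (q • x) y = q * ip x y
  lres_ip_top : ∀ (a : A) (x : X), a ⇀ ip x ⊤ = ip (a ⇀ x) ⊤
  sSup_ip : ∀ (S : Set X) (y : X), ip (sSup S) y = ⨆ x ∈ S, ip x y
  ip_symm : ∀ x y : X, ip x y = star (ip y x)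

/-- A supported `Q`-module, with support `sppX : X → A`. -/
class SupportedQModule (A Q X : Type u) [Order.Frame A] [Order.Frame Q] [Semigroup Q]
    [IsQuantale Q] [StarMul Q] [GroupoidQuantale A Q] [Order.Frame X] [SemigroupAction Q X]
    extends PreHilbertQModule A Q X where
  sppX : X → A
  sppX_mono : Monotone sppX
  sppX_top : sppX ⊤ = ⊤
  sppX_lres_top_le : ∀ x : X, sppX x ⇀ (⊤ : X) ≤ ip x x • (⊤ : X)
  sppX_lres_self : ∀ x : X, sppX x ⇀ x = x

/-- The module action `α : Q ⊗_A X → X`, `q ⊗ x ↦ q • x`, of a `Q`-module. -/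
def moduleAction (A Q X : Type u) [Order.Frame A] [Order.Frame Q] [Semigroup Q] [IsQuantale Q]
    [StarMul Q] [GroupoidQuantale A Q] [Order.Frame X] [SemigroupAction Q X] [QModule A Q X] :
    Tensor A Q X → X :=
  Tensor.lift fun (q : Q) (x : X) => q • x

/-- The map `α_* : X → Q ⊗_A X`, `α_* x = ⋁ {q ⊗ y | q • y ≤ x}`, of a `Q`-module. -/
def moduleCoaction (A Q X : Type u) [Order.Frame A] [Order.Frame Q] [Semigroup Q] [IsQuantale Q]
    [StarMul Q] [GroupoidQuantale A Q] [Order.Frame X] [SemigroupAction Q X] [QModule A Q X] :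
    X → Tensor A Q X :=
  Tensor.adj A fun (q : Q) (x : X) => q • x

theorem isBimorphism_smul (A Q X : Type u) [Order.Frame A] [Order.Frame Q] [Semigroup Q]
    [IsQuantale Q] [StarMul Q] [GroupoidQuantale A Q] [Order.Frame X] [SemigroupAction Q X]
    [QModule A Q X] : Tensor.IsBimorphism A fun (q : Q) (x : X) => q • x where
  sSup_left := QModule.sSup_smul A
  sSup_right := QModule.smul_sSup A
  balanced q a x := QModule.rres_smul a q x

/-- `α_*` is the right adjoint of `α`. -/
theorem gc_moduleAction (A Q X : Type u) [Order.Frame A] [Order.Frame Q] [Semigroup Q]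
    [IsQuantale Q] [StarMul Q] [GroupoidQuantale A Q] [Order.Frame X] [SemigroupAction Q X]
    [QModule A Q X] : GaloisConnection (moduleAction A Q X) (moduleCoaction A Q X) :=
  (isBimorphism_smul A Q X).gc

/-- A `Q`-locale: a stably supported `Q`-module such that the right adjoint
`x ↦ ⋁ {q ⊗ y | q • y ≤ x}` of the module action `Q ⊗_A X → X` preserves joins, and the unit law
`⋁ {υ q ⇀ y | q • y ≤ x} = x` holds. -/
class QLocale (A Q X : Type u) [Order.Frame A] [Order.Frame Q] [Semigroup Q]
    [IsQuantale Q] [StarMul Q] [GroupoidQuantale A Q] [Order.Frame X] [SemigroupAction Q X]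
    extends SupportedQModule A Q X where
  sppX_smul_le : ∀ (q : Q) (x : X), sppX (q • x) ≤ SupportedQuantale.spp q
  multiplicative : ∀ S : Set X, moduleCoaction A Q X (sSup S) = ⨆ x ∈ S, moduleCoaction A Q X x
  unit_laws : ∀ x : X,
    ⨆ (q : Q) (y : X) (_ : q • y ≤ x), (GroupoidQuantale.υ q : A) ⇀ y = x

end OpenGpd

/-!
The anchor map is the map of locales `p` with `p^* a = a ⇀ 1`. The support satisfies
`ς_X x ⇀ x = x` and, since `ς_X x = ς_Q ⟨x, 1⟩`, also `ς_X (a ⇀ x) = a ⊓ ς_X x`. These two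
identities say that `ς_X` is left adjoint to `p^*` and satisfies the Frobenius condition, so `p` is
open with `p_! = ς_X`; it is a surjection because `ς_X (p^* a) = a`.

Multiplicativity makes `α_*` the inverse image of a map of locales `𝔞`. Evaluated on generalized
elements, `𝔞` sends `(g, x)` to the map with inverse image `c ↦ ⋁ {g^* q ⊓ x^* y | q • y ≤ c}`,
so that its associativity and unit laws are those of the module. Finally `p ∘ 𝔞 = d ∘ π₁`
means `α_* (a ⇀ 1) = (a ⇀ 1) ⊗ 1`: if `q • x ≤ a ⇀ 1`, then
`ς_Q (q ↼ ς_X x) ≤ ς_X (q • x) ≤ a`, hence `q ⊗ x = (q ↼ ς_X x) ⊗ x ≤ (a ⇀ 1) ⊗ 1`.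
-/

namespace OpenGpd

open Tensor SupportedQuantale GroupoidQuantale QModule PreHilbertQModule SupportedQModule

section EquivariantSupport

variable {A M : Type u} [Order.Frame A] [Order.Frame M] [LeftAModule A M]

/-- An equivariant support on a locale `M` with a left action of `A`: the direct image of the map
`M → A` with inverse image `a ↦ a ⇀ 1`, when that map is open. No value is prescribed at `⊤`,
because the map need not be a surjection. -/
structure IsEquivariantSupport (s : M → A) : Prop where
  lres_self : ∀ x, s x ⇀ x = x
  map_lres : ∀ a x, s (a ⇀ x) = a ⊓ s x

namespace IsEquivariantSupport

variable [LeftLocalic A M] {s : M → A}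

theorem le_iff_le_lres_top (hs : IsEquivariantSupport s) {x : M} {a : A} :
    s x ≤ a ↔ x ≤ a ⇀ ⊤ := by
  constructor
  · intro h
    rw [← hs.lres_self x]
    exact lres_mono h le_top
  · intro h
    have hx : a ⇀ x = x := by rw [← lres_top_inf, inf_eq_right.2 h]
    rw [← hx, hs.map_lres]
    exact inf_le_left

theorem isDirectImage (hs : IsEquivariantSupport s) : IsDirectImage (mapOf (lresTop A M)) s :=
  fun _ _ => hs.le_iff_le_lres_top

theorem isOpenLocaleMap (hs : IsEquivariantSupport s) : IsOpenLocaleMap (mapOf (lresTop A M)) := by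
  have frobenius (x : M) (a : A) : s (x ⊓ (a ⇀ ⊤)) = s x ⊓ a := by
    rw [inf_comm, lres_top_inf, hs.map_lres, inf_comm]
  exact ⟨s, hs.isDirectImage, frobenius⟩

theorem isLocaleSurjection (hs : IsEquivariantSupport s) (htop : s ⊤ = ⊤) :
    IsLocaleSurjection (mapOf (lresTop A M)) := by
  have leftInverse (a : A) : s (a ⇀ ⊤) = a := by rw [hs.map_lres, htop, inf_top_eq]
  exact Function.LeftInverse.injective leftInverse

end IsEquivariantSupport

end EquivariantSupport

section InnerProduct

variable (A : Type u) {Q X : Type u} [Order.Frame A] [Order.Frame Q] [Semigroup Q] [IsQuantale Q]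
  [StarMul Q] [GroupoidQuantale A Q] [Order.Frame X] [SemigroupAction Q X]
  [PreHilbertQModule A Q X]

theorem ip_mono_left (y : X) : Monotone fun x : X => (ip A x y : Q) :=
  OrderHomClass.mono
    (⟨fun x => ip A x y, fun S => by rw [sSup_ip, sSup_image]⟩ : sSupHom X Q)

theorem ip_mono_right (x : X) : Monotone (ip A x : X → Q) := fun y y' h => by
  rw [ip_symm x y, ip_symm x y']
  exact star_mono A (ip_mono_left A x h)

theorem spp_ip_lres_top (a : A) (x : X) :
    (spp (ip A (a ⇀ x) (⊤ : X) : Q) : A) = a ⊓ spp (ip A x (⊤ : X) : Q) := by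
  rw [← lres_ip_top, spp_lres]

end InnerProduct

section Coaction

variable {A Q X : Type u} [Order.Frame A] [Order.Frame Q] [Semigroup Q] [IsQuantale Q] [StarMul Q]
  [GroupoidQuantale A Q] [Order.Frame X] [SemigroupAction Q X]

theorem mem_moduleCoaction [QModule A Q X] {q : Q} {x y : X} :
    (q, x) ∈ moduleCoaction A Q X y ↔ q • x ≤ y :=
  (isBimorphism_smul A Q X).mem_adj

/-- A supported `Q`-module `X` is stably supported if `ς_X (q • x) ≤ ς_Q q`. This is the part of
the structure of a `Q`-locale on which the properties of its anchor map depend. -/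
class StablySupported (A Q X : Type u) [Order.Frame A] [Order.Frame Q] [Semigroup Q]
    [IsQuantale Q] [StarMul Q] [GroupoidQuantale A Q] [Order.Frame X] [SemigroupAction Q X]
    [SupportedQModule A Q X] : Prop where
  sppX_smul_le : ∀ (q : Q) (x : X), (sppX Q (q • x) : A) ≤ spp q

instance [QLocale A Q X] : StablySupported A Q X where
  sppX_smul_le := QLocale.sppX_smul_le

section StablySupported

variable [SupportedQModule A Q X] [StablySupported A Q X]

theorem sppX_eq_spp_ip_top (x : X) : (sppX Q x : A) = spp (ip A x (⊤ : X) : Q) := by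
  apply le_antisymm
  · have x_le : x ≤ (sppX Q x : A) ⇀ ⊤ := by
      conv_lhs => rw [← sppX_lres_self (A := A) (Q := Q) x]
      exact lres_mono le_rfl le_top
    calc (sppX Q x : A) ≤ sppX Q ((ip A x x : Q) • (⊤ : X)) :=
          sppX_mono (x_le.trans (sppX_lres_top_le x))
      _ ≤ spp (ip A x x : Q) := StablySupported.sppX_smul_le _ _
      _ ≤ spp (ip A x (⊤ : X) : Q) := spp_mono A (ip_mono_right A x le_top)
  · conv_lhs => rw [← sppX_lres_self (A := A) (Q := Q) x, spp_ip_lres_top]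
    exact inf_le_left

theorem isEquivariantSupport_sppX : IsEquivariantSupport (sppX Q : X → A) where
  lres_self := sppX_lres_self
  map_lres a x := by rw [sppX_eq_spp_ip_top, sppX_eq_spp_ip_top, spp_ip_lres_top]

theorem spp_rres_sppX_le (q : Q) (x : X) : (spp (q ↼ (sppX Q x : A)) : A) ≤ sppX Q (q • x) := by
  rw [sppX_eq_spp_ip_top, sppX_eq_spp_ip_top, ip_smul]
  exact spp_rres_le _ _

theorem rres_sppX_le_lres_top {a : A} {q : Q} {x : X} (h : q • x ≤ a ⇀ (⊤ : X)) :
    q ↼ (sppX Q x : A) ≤ a ⇀ ⊤ :=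
  (le_lres_top_iff _ _).2
    ((spp_rres_sppX_le q x).trans (isEquivariantSupport_sppX.le_iff_le_lres_top.2 h))

theorem moduleCoaction_lres_top (a : A) :
    moduleCoaction A Q X (a ⇀ ⊤) = tmul A (a ⇀ (⊤ : Q)) (⊤ : X) := by
  apply le_antisymm
  · rintro ⟨q, x⟩ hqx
    have h : q ↼ (sppX Q x : A) ≤ a ⇀ ⊤ := rres_sppX_le_lres_top (mem_moduleCoaction.1 hqx)
    rw [← sppX_lres_self (A := A) (Q := Q) x]
    exact (Tensor.balanced _ _ _ _).1 (Tensor.lower _ h le_top (mem_tmul _ _))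
  · rw [tmul_le, mem_moduleCoaction, lres_smul]
    exact lres_mono le_rfl le_top

end StablySupported

end Coaction

section QLocale

variable (A Q X : Type u) [Order.Frame A] [Order.Frame Q] [Semigroup Q] [IsQuantale Q] [StarMul Q]
  [GroupoidQuantale A Q] [Order.Frame X] [SemigroupAction Q X] [QLocale A Q X]

/-- The right adjoint `α_*` of the module action, as a frame homomorphism: the inverse image of the
action `Q ⊗_A X → X` of the groupoid on a `Q`-locale. -/
def coactionHom : FrameHom X (Tensor A Q X) where
  toFun := moduleCoaction A Q X
  map_inf' _ _ := (gc_moduleAction A Q X).u_inf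
  map_top' := (gc_moduleAction A Q X).u_top
  map_sSup' S := by rw [QLocale.multiplicative, sSup_image]

theorem isGLocale_coactionHom :
    IsGLocale (groupoidOf A Q) (proj₁ A Q X) (proj₂ A Q X) (mapOf (lresTop A X))
      (mapOf (coactionHom A Q X)) where
  isPullback := Tensor.isPullback (fun _ => rfl) (fun _ => rfl)
  act_p := mapOf_ext moduleCoaction_lres_top
  assoc _ g h x _ _ :=
    (lift_assoc _ _ (isBimorphism_mul A Q) (isBimorphism_smul A Q X) (fun _ => rfl) (fun _ => rfl)
      mul_smul g h x _ _ _ _).symm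
  unit_act := mapOf_ext fun x =>
    calc
      _ = ⨆ (q : Q) (y : X) (_ : q • y ≤ x), ((υ q : A) ⇀ (⊤ : X)) ⊓ y :=
        frameHom_lift_comp _ _ _ _ (isBimorphism_smul A Q X) (fun _ => rfl) x
      _ = x := by simpa only [lres_top_inf] using QLocale.unit_laws (A := A) (Q := Q) x

theorem isFullyOpenGLocale_coactionHom :
    IsFullyOpenGLocale (groupoidOf A Q) (proj₁ A Q X) (proj₂ A Q X) (mapOf (lresTop A X))
      (mapOf (coactionHom A Q X)) where
  toIsGLocale := isGLocale_coactionHom A Q X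
  isOpen := (isEquivariantSupport_sppX (Q := Q)).isOpenLocaleMap
  surjective := (isEquivariantSupport_sppX (Q := Q)).isLocaleSurjection sppX_top

end QLocale

end OpenGpd

theorem mainTheorem4 {A Q X : Type u} [Order.Frame A] [Order.Frame Q] [Semigroup Q] [IsQuantale Q]
    [StarMul Q] [OpenGpd.GroupoidQuantale A Q] [Order.Frame X] [SemigroupAction Q X]
    [OpenGpd.QLocale A Q X] :
    ∃ (p : Locale.of X ⟶ Locale.of A)
      (act : OpenGpd.Tensor.prod A Q X ⟶ Locale.of X),
      OpenGpd.IsFullyOpenGLocale (OpenGpd.groupoidOf A Q) (OpenGpd.Tensor.proj₁ A Q X)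
        (OpenGpd.Tensor.proj₂ A Q X) p act ∧
      OpenGpd.IsDirectImage p (OpenGpd.SupportedQModule.sppX Q : X → A) ∧
      (∀ x : X, OpenGpd.frameHom act x = OpenGpd.moduleCoaction A Q X x) ∧
      GaloisConnection (OpenGpd.moduleAction A Q X) (OpenGpd.frameHom act) :=
  ⟨OpenGpd.mapOf (OpenGpd.lresTop A X), OpenGpd.mapOf (OpenGpd.coactionHom A Q X),
    OpenGpd.isFullyOpenGLocale_coactionHom A Q X,
    OpenGpd.isEquivariantSupport_sppX.isDirectImage,
    fun _ => rfl,
    OpenGpd.gc_moduleAction A Q X⟩
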